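/- All matrices are real. A symmetric $n\times n$ matrix $A$ is called completely positive if there are $d\ge 1$ and entrywise nonnegative vectors $x_1,\dots,x_n\in\mathbb{R}^d$ with $A_{ij}=x_i^{T}x_j$ for all $i,j$; it is called completely positive semidefinite if there are $d\ge 1$ and symmetric positive semidefinite $d\times d$ matrices $X_1,\dots,X_n$ with $A_{ij}=\operatorname{Tr}(X_iX_j)$ for all $i,j$. Let $\mathcal{DNN}^n$ be the cone of $n\times n$ matrices that are both positive semidefinite and entrywise nonnegative. The support graph $G(A)$ of a symmetric matrix $A$ has vertex set $\{1,\dots,n\}$, with $i\neq j$ adjacent if and only if $A_{ij}\neq 0$. An extreme ray of a convex cone $K$ is a half-line $R=\{t x: t\ge 0\}\subseteq K$ with $x\neq 0$ such that whenever $y,z\in K$ and $y+z\in R$, then $y,z\in R$. 1. Let $n\ge 5$ be odd. If $A$ is a symmetric $n\times n$ matrix whose support graph is a cycle of length $n$ (that is, $G(A)$ is isomorphic to $C_n$) and $\operatorname{rank} A=n-2$, then $A$ is not completely positive semidefinite. 2. If a symmetric $5\times 5$ matrix $A$ lies on an extreme ray of $\mathcal{DNN}^5$, then $A$ is completely positive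 semidefinite if and only if $A$ is completely positive. -/

import Mathlib

/-- `A` is completely positive: `A` is the Gram matrix of entrywise nonnegative vectors
`x₁, …, xₙ ∈ ℝᵈ` for some `d ≥ 1`. -/
def IsCompletelyPositive {n : ℕ} (A : Matrix (Fin n) (Fin n) ℝ) : Prop :=
  ∃ d : ℕ, 1 ≤ d ∧ ∃ x : Fin n → Fin d → ℝ,
    (∀ i k, 0 ≤ x i k) ∧ ∀ i j, A i j = x i ⬝ᵥ x j

/-- `A` is completely positive semidefinite: `A` is the Gram matrix, for the trace inner product
`⟨X, Y⟩ = Tr(Xᵀ Y)`, of real symmetric positive semidefinite matrices `X₁, …, Xₙ` of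
some common size `d ≥ 1`. -/
def IsCompletelyPSD {n : ℕ} (A : Matrix (Fin n) (Fin n) ℝ) : Prop :=
  ∃ d : ℕ, 1 ≤ d ∧ ∃ X : Fin n → Matrix (Fin d) (Fin d) ℝ,
    (∀ i, (X i).PosSemidef) ∧ ∀ i j, A i j = ((X i).transpose * X j).trace

/-- The doubly nonnegative cone: positive semidefinite (in particular symmetric) and entrywise
nonnegative real matrices. -/
def doublyNonnegative (n : ℕ) : Set (Matrix (Fin n) (Fin n) ℝ) :=
  {A | A.PosSemidef ∧ ∀ i j, 0 ≤ A i j}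

/-- The support graph of a symmetric matrix: `i` and `j` are adjacent when `i ≠ j` and
`A i j ≠ 0` (the relation is symmetrized, which changes nothing for symmetric `A`). -/
def supportGraph {n : ℕ} (A : Matrix (Fin n) (Fin n) ℝ) : SimpleGraph (Fin n) :=
  SimpleGraph.fromRel fun i j => A i j ≠ 0

/-- `R` is an extreme ray of the convex cone `K`: a half-line `{t x : t ≥ 0}` with `x ≠ 0`
that is an extreme subset (a face) of `K`. -/
def IsExtremeRay {E : Type*} [AddCommGroup E] [Module ℝ E] (K R : Set E) : Prop :=
  (∃ x : E, x ≠ 0 ∧ R = {y | ∃ t : ℝ, 0 ≤ t ∧ y = t • x}) ∧ IsExtreme ℝ K R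

open Matrix Filter Topology

/-! Both statements rest on `IsCompletelyPSD.le_rank_add_one`. If the corank is at least two, some
nonzero kernel vector `c` vanishes at a vertex, and `∑ c k • X k = 0`. Sandwich this between `X i`
and `X j` for an edge `ij` with `c i = 0`: non-edges give zero products and there are no triangles,
so only `c j • X i * X j ^ 2` survives. Hence `c j = 0`, and connectedness spreads this to all of
`c`. A cycle of rank `n - 2` contradicts the bound.

For the `5 × 5` case, take an extremal `A` of rank `r` that is not completely positive. Perturbing
its Gram factor shows that every vertex of positive diagonal has two non-adjacent neighbours, so
there are at most five non-adjacent pairs. A dimension count gives `(r + 1).choose 2 ≤ pairs + 1`,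
so `r ≤ 3`, while rank at most two would make `A` completely positive. Thus `r = 3` with exactly
five pairs, the support is a pentagon, and the corank bound fails. -/

/-! ### Gram factors and products of positive semidefinite matrices -/

/-- A real positive semidefinite matrix is the Gram matrix of vectors in dimension `A.rank`, and
these vectors span the space. -/
theorem exists_gram_factor {n : ℕ} {A : Matrix (Fin n) (Fin n) ℝ} (hA : A.PosSemidef) :
    ∃ r, A.rank = r ∧ ∃ V : Matrix (Fin r) (Fin n) ℝ, Vᵀ * V = A ∧
      ∃ W : Matrix (Fin n) (Fin r) ℝ, V * W = 1 := by
  have hH := hA.isHermitian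
  let U : Matrix (Fin n) (Fin n) ℝ := hH.eigenvectorUnitary
  obtain ⟨e⟩ : Nonempty (Fin A.rank ≃ {i // hH.eigenvalues i ≠ 0}) :=
    Fintype.card_eq.1 (by rw [Fintype.card_fin, hH.rank_eq_card_non_zero_eigs])
  let V : Matrix (Fin A.rank) (Fin n) ℝ :=
    Matrix.of fun k i => √(hH.eigenvalues (e k)) * U i (e k)
  have hV : Vᵀ * V = A := by
    ext i j
    have hsp := congrFun (congrFun hH.spectral_theorem i) j
    rw [hsp, Unitary.conjStarAlgAut_apply, mul_apply, mul_apply]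
    simp only [mul_diagonal, star_eq_conjTranspose, conjTranspose_apply, star_trivial,
      Function.comp_apply, RCLike.ofReal_real_eq_id, id_eq, transpose_apply, V, of_apply]
    refine Fintype.sum_of_injective (fun k => (e k : Fin n))
      (Subtype.val_injective.comp e.injective) _ _ (fun k hk => ?_) fun k => ?_
    · have hk0 : hH.eigenvalues k = 0 := by
        by_contra h
        exact hk ⟨e.symm ⟨k, h⟩, by simp⟩
      simp [hk0]
    · have hs := Real.mul_self_sqrt (hA.eigenvalues_nonneg (e k))
      linear_combination (U i (e k) * U j (e k)) * hs
  refine ⟨_, rfl, V, hV, mulVec_surjective_iff_exists_right_inverse.1 ?_⟩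
  have hrank : V.rank = A.rank := by rw [← rank_transpose_mul_self, hV]
  refine (LinearMap.range_eq_top (f := V.mulVecLin)).1 (Submodule.eq_top_of_finrank_eq ?_)
  rw [Module.finrank_fin_fun]
  exact hrank

/-- Two real positive semidefinite matrices that are orthogonal for the trace inner product have
product zero. -/
theorem mul_eq_zero_of_trace_mul_eq_zero {d : ℕ} {X Y : Matrix (Fin d) (Fin d) ℝ}
    (hX : X.PosSemidef) (hY : Y.PosSemidef) (h : (X * Y).trace = 0) : X * Y = 0 := by
  obtain ⟨_, -, V, hV, -⟩ := exists_gram_factor hX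
  obtain ⟨_, -, W, hW, -⟩ := exists_gram_factor hY
  rw [← conjTranspose_eq_transpose_of_trivial] at hV hW
  rw [← hV, ← hW] at h ⊢
  have h0 : V * Wᴴ = 0 := by
    rw [← trace_conjTranspose_mul_self_eq_zero_iff]
    rw [← h, conjTranspose_mul, conjTranspose_conjTranspose, Matrix.mul_assoc,
      trace_mul_comm, Matrix.mul_assoc, Matrix.mul_assoc, Matrix.mul_assoc]
  calc Vᴴ * V * (Wᴴ * W) = Vᴴ * (V * Wᴴ) * W := by simp only [Matrix.mul_assoc]
    _ = 0 := by rw [h0, Matrix.mul_zero, Matrix.zero_mul]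

/-- If `X * Y ^ 2` vanishes for symmetric matrices, then so does `X * Y`. -/
theorem mul_eq_zero_of_mul_mul_self_eq_zero {d : ℕ} {X Y : Matrix (Fin d) (Fin d) ℝ}
    (hX : X.PosSemidef) (hY : Y.PosSemidef) (h : X * (Y * Y) = 0) : X * Y = 0 := by
  rw [← self_mul_conjTranspose_eq_zero, conjTranspose_mul, hX.isHermitian.eq, hY.isHermitian.eq]
  calc X * Y * (Y * X) = X * (Y * Y) * X := by simp only [Matrix.mul_assoc]
    _ = 0 := by simp [h]

/-! ### Corank bound for triangle-free supports -/

/-- The squared Frobenius norm of the combination is `c ⬝ᵥ A *ᵥ c`. -/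
theorem sum_smul_eq_zero_of_mulVec_eq_zero {n d : ℕ} {A : Matrix (Fin n) (Fin n) ℝ}
    {X : Fin n → Matrix (Fin d) (Fin d) ℝ} (hA : ∀ i j, A i j = ((X i)ᵀ * X j).trace)
    {c : Fin n → ℝ} (hc : A *ᵥ c = 0) : ∑ i, c i • X i = 0 := by
  rw [← trace_conjTranspose_mul_self_eq_zero_iff]
  have h : c ⬝ᵥ (A *ᵥ c) = 0 := by simp [hc]
  rw [← h, conjTranspose_eq_transpose_of_trivial, transpose_sum, Matrix.sum_mul, trace_sum]
  simp only [trace_sum, transpose_smul, Matrix.smul_mul, Matrix.mul_smul, trace_smul,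
    ← hA, dotProduct, mulVec, Finset.mul_sum, smul_eq_mul]
  exact Finset.sum_congr rfl fun i _ => Finset.sum_congr rfl fun j _ => by ring

theorem supportGraph_adj {n : ℕ} {A : Matrix (Fin n) (Fin n) ℝ} (hA : A.IsSymm) {i j : Fin n} :
    (supportGraph A).Adj i j ↔ i ≠ j ∧ A i j ≠ 0 := by
  simp [supportGraph, SimpleGraph.fromRel_adj, hA.apply j i]

/-- A completely positive semidefinite matrix with connected triangle-free support has corank at
most one. -/
theorem IsCompletelyPSD.le_rank_add_one {n : ℕ} {A : Matrix (Fin n) (Fin n) ℝ}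
    (hA : IsCompletelyPSD A) (hconn : (supportGraph A).Preconnected)
    (htri : (supportGraph A).CliqueFree 3) : n ≤ A.rank + 1 := by
  obtain ⟨d, -, X, hX, hAX⟩ := hA
  have hT : ∀ i, (X i)ᵀ = X i := fun i => by
    simpa [conjTranspose_eq_transpose_of_trivial] using (hX i).isHermitian.eq
  have hsymm : A.IsSymm := by
    ext i j
    rw [transpose_apply, hAX, hAX, hT, hT, trace_mul_comm]
  have hzero : ∀ i j, A i j = 0 → X i * X j = 0 := fun i j h =>
    mul_eq_zero_of_trace_mul_eq_zero (hX i) (hX j) (by rw [← h, hAX, hT])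
  by_contra! hlt
  have : NeZero n := ⟨by omega⟩
  have hker : 1 < Module.finrank ℝ (LinearMap.ker A.mulVecLin) := by
    have h := A.mulVecLin.finrank_range_add_finrank_ker
    rw [Module.finrank_fin_fun] at h
    have h' : A.rank = Module.finrank ℝ (LinearMap.range A.mulVecLin) := rfl
    omega
  let φ : LinearMap.ker A.mulVecLin →ₗ[ℝ] ℝ :=
    (LinearMap.proj (0 : Fin n)).comp (LinearMap.ker A.mulVecLin).subtype
  have hφ : LinearMap.ker φ ≠ ⊥ := φ.ker_ne_bot_of_finrank_lt (by simpa using hker)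
  obtain ⟨⟨c, hc⟩, hc0, hne⟩ := Submodule.exists_mem_ne_zero_of_ne_bot hφ
  have hc0 : c 0 = 0 := hc0
  have hsum := sum_smul_eq_zero_of_mulVec_eq_zero hAX (c := c) hc
  have hstep : ∀ i j, (supportGraph A).Adj i j → c i = 0 → c j = 0 := by
    intro i j hij hi
    have h := congrArg (fun Z => X i * Z * X j) hsum
    simp only [Matrix.mul_sum, Matrix.sum_mul, Matrix.mul_zero, Matrix.zero_mul] at h
    rw [Finset.sum_eq_single j] at h
    · simp only [Matrix.mul_smul, Matrix.smul_mul, smul_eq_zero, Matrix.mul_assoc] at h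
      refine h.resolve_right fun h0 => ((supportGraph_adj hsymm).1 hij).2 ?_
      rw [hAX, hT, mul_eq_zero_of_mul_mul_self_eq_zero (hX i) (hX j) h0, trace_zero]
    · intro k _ hkj
      by_cases hik : i = k
      · simp [← hik, hi]
      by_cases h1 : A i k = 0
      · simp [hzero i k h1]
      by_cases h2 : A k j = 0
      · simp [Matrix.mul_assoc, hzero k j h2]
      exact absurd (SimpleGraph.is3Clique_iff.2 ⟨i, k, j, (supportGraph_adj hsymm).2 ⟨hik, h1⟩,
        hij, (supportGraph_adj hsymm).2 ⟨hkj, h2⟩, rfl⟩) (htri _)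
    · simp
  have hall : ∀ j, c j = 0 := fun j => by
    obtain ⟨w⟩ := hconn 0 j
    have : ∀ {u v} (_ : (supportGraph A).Walk u v), c u = 0 → c v = 0 := by
      intro u v w
      induction w with
      | nil => exact id
      | cons h _ ih => exact fun hu => ih (hstep _ _ h hu)
    exact this w hc0
  exact hne (Subtype.ext (funext hall))

theorem cycleGraph_cliqueFree_three {n : ℕ} (hn : 4 ≤ n) :
    (SimpleGraph.cycleGraph n).CliqueFree 3 := by
  have : NeZero n := ⟨by omega⟩
  intro s hs
  obtain ⟨a, b, c, hab, hac, hbc, -⟩ := SimpleGraph.is3Clique_iff.1 hs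
  rw [SimpleGraph.cycleGraph_adj'] at hab hac hbc
  -- Modular adjacency becomes "differ by `1` or `n - 1`" in `ℕ`, within reach of `omega`.
  have key : ∀ u v : Fin n, (u - v).val = 1 ∨ (v - u).val = 1 →
      (u.val = v.val + 1 ∨ v.val = u.val + 1 ∨ u.val = v.val + (n - 1) ∨
        v.val = u.val + (n - 1)) := by
    intro u v h
    rcases le_total u v with huv | huv
    · rw [Fin.sub_val_of_le huv] at h
      rcases huv.eq_or_lt with rfl | hlt
      · simp at h
      · rw [Fin.coe_sub_iff_lt.2 hlt] at h
        omega
    · rw [Fin.sub_val_of_le huv] at h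
      rcases huv.eq_or_lt with rfl | hlt
      · simp at h
      · rw [Fin.coe_sub_iff_lt.2 hlt] at h
        omega
  have h1 := key _ _ hab
  have h2 := key _ _ hac
  have h3 := key _ _ hbc
  omega

theorem not_isCompletelyPSD_of_cycle {n : ℕ} (hn : 4 ≤ n) {A : Matrix (Fin n) (Fin n) ℝ}
    (e : supportGraph A ≃g SimpleGraph.cycleGraph n) (hr : A.rank = n - 2) :
    ¬ IsCompletelyPSD A := by
  intro hA
  have hconn : (supportGraph A).Preconnected :=
    e.preconnected_iff.2 SimpleGraph.cycleGraph_preconnected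
  have htri : (supportGraph A).CliqueFree 3 :=
    (cycleGraph_cliqueFree_three hn).comap ⟨e.toHom, e.injective⟩
  have := hA.le_rank_add_one hconn htri
  omega

/-! ### Perturbations along extreme rays -/

theorem exists_quadratic_form_bound {r : ℕ} (S : Matrix (Fin r) (Fin r) ℝ) :
    ∃ C : ℝ, ∀ x : Fin r → ℝ, |x ⬝ᵥ (S *ᵥ x)| ≤ C * (x ⬝ᵥ x) := by
  refine ⟨∑ k, ∑ l, |S k l|, fun x => ?_⟩
  have hx : ∀ k, x k ^ 2 ≤ x ⬝ᵥ x := fun k => by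
    rw [pow_two]
    exact Finset.single_le_sum (f := fun k => x k * x k) (fun i _ => mul_self_nonneg _)
      (Finset.mem_univ k)
  have hxS : x ⬝ᵥ (S *ᵥ x) = ∑ k, ∑ l, x k * (S k l * x l) := by
    simp only [dotProduct, mulVec, Finset.mul_sum]
  rw [hxS, Finset.sum_mul]
  simp only [Finset.sum_mul]
  refine (Finset.abs_sum_le_sum_abs _ _).trans ?_
  refine (Finset.sum_le_sum fun k _ => Finset.abs_sum_le_sum_abs _ _).trans ?_
  refine Finset.sum_le_sum fun k _ => Finset.sum_le_sum fun l _ => ?_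
  rw [abs_mul, abs_mul]
  have h1 : |x k| * |x l| ≤ x ⬝ᵥ x := by
    nlinarith [hx k, hx l, sq_abs (x k), sq_abs (x l), sq_nonneg (|x k| - |x l|)]
  nlinarith [abs_nonneg (S k l)]

/-- `Vᵀ (1 + ε S) V` stays positive semidefinite for small `ε`. -/
theorem eventually_posSemidef_add_smul {n r : ℕ} (V : Matrix (Fin r) (Fin n) ℝ)
    {S : Matrix (Fin r) (Fin r) ℝ} (hS : S.IsSymm) :
    ∀ᶠ ε : ℝ in 𝓝[>] 0, (Vᵀ * V + ε • (Vᵀ * S * V)).PosSemidef := by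
  obtain ⟨C, hC⟩ := exists_quadratic_form_bound S
  have h1 : ∀ᶠ ε : ℝ in 𝓝 0, ε * C < 1 :=
    (by fun_prop : Continuous fun ε : ℝ => ε * C).tendsto 0 |>.eventually_lt_const (by simp)
  filter_upwards [h1.filter_mono nhdsWithin_le_nhds, self_mem_nhdsWithin] with ε hε (hpos : 0 < ε)
  have h : (1 + ε • S).PosSemidef := by
    refine PosSemidef.of_dotProduct_mulVec_nonneg ?_ fun x => ?_
    · rw [IsHermitian, conjTranspose_eq_transpose_of_trivial, transpose_add, transpose_smul,
        hS.eq, transpose_one]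
    · rw [star_trivial, add_mulVec, one_mulVec, dotProduct_add, smul_mulVec, dotProduct_smul,
        smul_eq_mul]
      have hx : 0 ≤ x ⬝ᵥ x := by simpa using dotProduct_star_self_nonneg x
      have := (abs_le.1 (hC x)).1
      nlinarith
  have h' := h.conjTranspose_mul_mul_same V
  rw [conjTranspose_eq_transpose_of_trivial, Matrix.mul_add, Matrix.add_mul, Matrix.mul_one,
    Matrix.mul_smul, Matrix.smul_mul] at h'
  exact h'

theorem eventually_nonneg_add_smul {n : ℕ} {A M : Matrix (Fin n) (Fin n) ℝ}
    (hA : ∀ i j, 0 ≤ A i j) (hM : ∀ i j, A i j = 0 → M i j = 0) :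
    ∀ᶠ ε : ℝ in 𝓝[>] 0, ∀ i j, 0 ≤ (A + ε • M) i j := by
  rw [eventually_all]
  intro i
  rw [eventually_all]
  intro j
  simp only [Matrix.add_apply, Matrix.smul_apply, smul_eq_mul]
  rcases (hA i j).eq_or_lt with h | h
  · simp [← h, hM i j h.symm]
  · have h1 : ∀ᶠ ε : ℝ in 𝓝 0, 0 < A i j + ε * M i j :=
      (by fun_prop : Continuous fun ε : ℝ => A i j + ε * M i j).tendsto 0
        |>.eventually_const_lt (by simpa)
    exact (h1.filter_mono nhdsWithin_le_nhds).mono fun ε h => h.le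

/-- On an extreme ray of the doubly nonnegative cone, a symmetric perturbation inside the face of
the positive semidefinite cone that respects the support is a multiple of the matrix itself. -/
theorem IsExtremeRay.exists_eq_smul {n r : ℕ} {A : Matrix (Fin n) (Fin n) ℝ}
    {R : Set (Matrix (Fin n) (Fin n) ℝ)} (hR : IsExtremeRay (doublyNonnegative n) R)
    (hAR : A ∈ R) (hA0 : A ≠ 0) {V : Matrix (Fin r) (Fin n) ℝ} (hV : Vᵀ * V = A)
    {S : Matrix (Fin r) (Fin r) ℝ} (hS : S.IsSymm)
    (hsupp : ∀ i j, A i j = 0 → (Vᵀ * S * V) i j = 0) : ∃ t : ℝ, Vᵀ * S * V = t • A := by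
  obtain ⟨⟨x, -, hRx⟩, hext⟩ := hR
  have hA := hext.subset hAR
  -- Perturbing by both `S` and `-S` makes `A` the midpoint of two points of the cone.
  have hM : Vᵀ * (-S) * V = -(Vᵀ * S * V) := by simp
  have hSn : (-S).IsSymm := by rw [IsSymm, transpose_neg, hS.eq]
  obtain ⟨ε, h1, h2, h3, h4, hpos⟩ := ((eventually_posSemidef_add_smul V hS).and
    ((eventually_posSemidef_add_smul V hSn).and
    ((eventually_nonneg_add_smul hA.2 hsupp).and
    ((eventually_nonneg_add_smul (M := -(Vᵀ * S * V)) hA.2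
      fun i j h => by simp [hsupp i j h]).and self_mem_nhdsWithin)))).exists
  have hpos : 0 < ε := hpos
  rw [hV] at h1 h2
  rw [hM] at h2
  have hmem : A + ε • (Vᵀ * S * V) ∈ R := by
    refine hext.left_mem_of_mem_openSegment ⟨h1, h3⟩ ⟨h2, h4⟩ hAR
      ⟨1 / 2, 1 / 2, by norm_num, by norm_num, by norm_num, ?_⟩
    module
  rw [hRx] at hmem hAR
  obtain ⟨s, -, hs⟩ := hmem
  obtain ⟨t, -, rfl⟩ := hAR
  have ht : t ≠ 0 := by
    rintro rfl
    simp at hA0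
  refine ⟨ε⁻¹ * (s * t⁻¹ - 1), ?_⟩
  have h : ε • (Vᵀ * S * V) = (s - t) • x := by
    rw [sub_smul, ← hs]
    abel
  rw [← inv_smul_smul₀ hpos.ne' (Vᵀ * S * V), h, smul_smul, smul_smul]
  congr 1
  field_simp

/-! ### Extreme rays that are completely positive -/

theorem gram_col_eq_zero {n r : ℕ} {A : Matrix (Fin n) (Fin n) ℝ} {V : Matrix (Fin r) (Fin n) ℝ}
    (hV : Vᵀ * V = A) {i : Fin n} (hi : A i i = 0) (k : Fin r) : V k i = 0 := by
  rw [← hV, mul_apply] at hi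
  have := (Finset.sum_eq_zero_iff_of_nonneg
    (fun k _ => by simpa using mul_self_nonneg (V k i))).1 hi k (Finset.mem_univ k)
  simpa using this

theorem entry_ne_zero_imp_diag_ne_zero {n : ℕ} {A : Matrix (Fin n) (Fin n) ℝ}
    (hA : A.PosSemidef) {i j : Fin n} (h : A i j ≠ 0) : A i i ≠ 0 ∧ A j j ≠ 0 := by
  obtain ⟨_, -, V, hV, -⟩ := exists_gram_factor hA
  refine ⟨fun hi => h ?_, fun hj => h ?_⟩
  · rw [← hV, mul_apply]
    simp [gram_col_eq_zero hV hi]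
  · rw [← hV, mul_apply]
    simp [gram_col_eq_zero hV hj]

/-- When the neighbours of `i` form a clique, the rank-one matrix built from row `i` respects the
support of `A`. It comes from perturbing by `v vᵀ`, with `v` the Gram vector of `i`, so extremality
makes `A` proportional to it. -/
theorem isCompletelyPositive_of_simplicial {n : ℕ} {A : Matrix (Fin n) (Fin n) ℝ}
    {R : Set (Matrix (Fin n) (Fin n) ℝ)} (hR : IsExtremeRay (doublyNonnegative n) R)
    (hAR : A ∈ R) {i : Fin n} (hi : A i i ≠ 0)
    (hcl : ∀ j k, A i j ≠ 0 → A i k ≠ 0 → A j k ≠ 0) : IsCompletelyPositive A := by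
  have hA := hR.2.subset hAR
  obtain ⟨_, -, V, hV, -⟩ := exists_gram_factor hA.1
  have hsymm : ∀ j k, A j k = A k j := fun j k => by
    simpa using (hA.1.isHermitian.apply j k).symm
  have hM : ∀ j k, (Vᵀ * vecMulVec (V.col i) (V.col i) * V) j k = A i j * A i k := by
    intro j k
    rw [mul_vecMulVec, vecMulVec_mul, vecMulVec_apply, hsymm i j]
    simp only [← hV]
    rfl
  obtain ⟨t, ht⟩ := hR.exists_eq_smul hAR (fun h => hi (by simp [h])) hV
    (S := vecMulVec (V.col i) (V.col i)) (by rw [IsSymm, transpose_vecMulVec]) (by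
      intro j k hjk
      rw [hM]
      by_contra! h
      exact hcl j k (left_ne_zero_of_mul h) (right_ne_zero_of_mul h) hjk)
  have hentry : ∀ j k, A i j * A i k = t * A j k := fun j k => by
    rw [← hM, ht, Matrix.smul_apply, smul_eq_mul]
  have hti : A i i = t := mul_right_cancel₀ hi (hentry i i)
  have hpos : 0 < A i i := (hA.2 i i).lt_of_ne' hi
  refine ⟨1, le_rfl, fun j _ => A i j / √(A i i), fun j _ => div_nonneg (hA.2 _ _) (by positivity),
    fun j k => ?_⟩
  simp only [dotProduct, Finset.univ_unique, Finset.sum_singleton]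
  rw [div_mul_div_comm, Real.mul_self_sqrt hpos.le, hentry, ← hti]
  field_simp

/-- The Gram vectors of `j` and `k`, normalized, form an orthonormal basis of the plane; in it every
Gram vector has coordinates that are nonnegative multiples of entries of `A`. -/
theorem isCompletelyPositive_of_rank_le_two {n : ℕ} {A : Matrix (Fin n) (Fin n) ℝ}
    (hA : A ∈ doublyNonnegative n) (hr : A.rank ≤ 2) {j k : Fin n} (hjk : A j k = 0)
    (hj : A j j ≠ 0) (hk : A k k ≠ 0) : IsCompletelyPositive A := by
  obtain ⟨r, hrank, V, hV, -⟩ := exists_gram_factor hA.1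
  rw [hrank] at hr
  have hj' : 0 < A j j := (hA.2 j j).lt_of_ne' hj
  have hk' : 0 < A k k := (hA.2 k k).lt_of_ne' hk
  have hkj : A k j = 0 := by
    rw [← hjk]
    simpa using (hA.1.isHermitian.apply k j).symm
  let s : Fin 2 → Fin n := ![j, k]
  let W : Matrix (Fin n) (Fin 2) ℝ := Matrix.of fun i a => if i = s a then (√(A i i))⁻¹ else 0
  have hVW : ∀ i a, (A * W) i a = A i (s a) * (√(A (s a) (s a)))⁻¹ := by
    intro i a
    simp [mul_apply, W]
  have hWW : (V * W)ᵀ * (V * W) = 1 := by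
    have : (V * W)ᵀ * (V * W) = Wᵀ * (A * W) := by
      rw [← hV, transpose_mul]
      simp only [Matrix.mul_assoc]
    rw [this]
    ext a b
    have : (Wᵀ * (A * W)) a b = (√(A (s a) (s a)))⁻¹ * (A * W) (s a) b := by
      rw [mul_apply]
      simp [W]
    rw [this, hVW]
    fin_cases a <;> fin_cases b <;> simp [s, hjk, hkj]
    · rw [mul_comm, mul_assoc, ← mul_inv, Real.mul_self_sqrt hj'.le, mul_inv_cancel₀ hj]
    · rw [mul_comm, mul_assoc, ← mul_inv, Real.mul_self_sqrt hk'.le, mul_inv_cancel₀ hk]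
  obtain rfl : r = 2 := by
    refine le_antisymm hr ?_
    have h1 : ((V * W)ᵀ * (V * W)).rank = 2 := by rw [hWW, rank_one, Fintype.card_fin]
    rw [rank_transpose_mul_self] at h1
    have := rank_le_card_height (V * W)
    rw [h1, Fintype.card_fin] at this
    exact this
  have hWW' : (V * W) * (V * W)ᵀ = 1 := mul_eq_one_comm.1 hWW
  have hAW : A = (A * W) * (A * W)ᵀ := by
    calc A = Vᵀ * (V * W * (V * W)ᵀ) * V := by rw [hWW', Matrix.mul_one, hV]
      _ = (Vᵀ * V * W) * (Vᵀ * V * W)ᵀ := by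
        simp only [transpose_mul, transpose_transpose, Matrix.mul_assoc]
      _ = _ := by rw [hV]
  refine ⟨2, by norm_num, fun i => (A * W) i, fun i a => ?_, fun i l => ?_⟩
  · change 0 ≤ (A * W) i a
    rw [hVW]
    exact mul_nonneg (hA.2 _ _) (by positivity)
  · conv_lhs => rw [hAW]
    rfl

/-! ### Dimension count on an extreme ray -/

/-- Dimension count: fewer linear conditions than symmetric matrices modulo the identity. -/
theorem exists_isSymm_of_card_lt {ι : Type*} [Fintype ι] {r : ℕ}
    (φ : Matrix (Fin r) (Fin r) ℝ →ₗ[ℝ] ι → ℝ)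
    (h : Fintype.card ι + 1 < (r + 1).choose 2) :
    ∃ S : Matrix (Fin r) (Fin r) ℝ, S.IsSymm ∧ φ S = 0 ∧ ∀ t : ℝ, S ≠ t • 1 := by
  obtain _ | r := r
  · simp at h
  let L : (Sym2 (Fin (r + 1)) → ℝ) →ₗ[ℝ] Matrix (Fin (r + 1)) (Fin (r + 1)) ℝ :=
    { toFun := fun f => Matrix.of fun k l => f s(k, l)
      map_add' := fun _ _ => rfl
      map_smul' := fun _ _ => rfl }
  have hL : ∀ f k l, L f k l = f s(k, l) := fun _ _ _ => rfl
  -- The extra condition that the `(0, 0)` entry vanish excludes nonzero multiples of the identity;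
  -- it is the `+ 1` in `h`.
  let ψ : (Sym2 (Fin (r + 1)) → ℝ) →ₗ[ℝ] (ι → ℝ) × ℝ :=
    (φ.comp L).prod (LinearMap.proj s(0, 0))
  have hψ : LinearMap.ker ψ ≠ ⊥ := ψ.ker_ne_bot_of_finrank_lt (by
    simpa [Sym2.card] using h)
  obtain ⟨f, hf, hne⟩ := Submodule.exists_mem_ne_zero_of_ne_bot hψ
  have hf' : φ (L f) = 0 ∧ f s(0, 0) = 0 := Prod.ext_iff.1 hf
  refine ⟨L f, ?_, hf'.1, fun t ht => hne ?_⟩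
  · ext k l
    rw [transpose_apply, hL, hL, Sym2.eq_swap]
  · have h00 := congrFun (congrFun ht 0) 0
    have ht0 : t = 0 := by simpa [hL, hf'.2] using h00.symm
    ext p
    induction p with
    | _ k l => simpa [hL, ht0] using congrFun (congrFun ht k) l

/-- The pairs `i < j` of non-adjacent vertices of positive diagonal. -/
noncomputable def nonadjacentPairs {n : ℕ} (A : Matrix (Fin n) (Fin n) ℝ) :
    Finset (Fin n × Fin n) :=
  open Classical in {p | p.1 < p.2 ∧ A p.1 p.2 = 0 ∧ A p.1 p.1 ≠ 0 ∧ A p.2 p.2 ≠ 0}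

/-- Otherwise some symmetric `S`, not a multiple of `1`, satisfies all the vanishing conditions at
non-adjacent pairs. Extremality gives `Vᵀ * S * V = t • A`, and the right inverse of `V` turns this
into `S = t • 1`. -/
theorem IsExtremeRay.choose_rank_le {n : ℕ} {A : Matrix (Fin n) (Fin n) ℝ}
    {R : Set (Matrix (Fin n) (Fin n) ℝ)} (hR : IsExtremeRay (doublyNonnegative n) R)
    (hAR : A ∈ R) (hA0 : A ≠ 0) :
    (A.rank + 1).choose 2 ≤ (nonadjacentPairs A).card + 1 := by
  by_contra! hlt
  have hA := hR.2.subset hAR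
  obtain ⟨r, hr, V, hV, W, hW⟩ := exists_gram_factor hA.1
  rw [hr] at hlt
  let φ : Matrix (Fin r) (Fin r) ℝ →ₗ[ℝ] nonadjacentPairs A → ℝ :=
    { toFun := fun S p => (Vᵀ * S * V) p.1.1 p.1.2
      map_add' := fun S T => by ext p; simp [Matrix.mul_add, Matrix.add_mul]
      map_smul' := fun c S => by ext p; simp }
  obtain ⟨S, hS, hφ, hne⟩ := exists_isSymm_of_card_lt φ (by simpa using hlt)
  have hMsymm : ∀ i j, (Vᵀ * S * V) i j = (Vᵀ * S * V) j i := fun i j => by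
    have : (Vᵀ * S * V)ᵀ = Vᵀ * S * V := by
      simp only [transpose_mul, transpose_transpose, hS.eq, Matrix.mul_assoc]
    exact congrFun (congrFun this j) i
  have hcol' : ∀ i j, A j j = 0 → (Vᵀ * S * V) i j = 0 := fun i j hj => by
    rw [mul_apply]
    simp [gram_col_eq_zero hV hj]
  have hlt' : ∀ i j, i < j → A i j = 0 → (Vᵀ * S * V) i j = 0 := by
    intro i j hij h
    by_cases hj : A j j = 0
    · exact hcol' i j hj
    by_cases hi : A i i = 0
    · rw [hMsymm]
      exact hcol' j i hi
    exact congrFun hφ ⟨(i, j), by simp [nonadjacentPairs, *]⟩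
  obtain ⟨t, ht⟩ := hR.exists_eq_smul hAR hA0 hV hS (by
    intro i j h
    rcases lt_trichotomy i j with hij | rfl | hij
    · exact hlt' i j hij h
    · exact hcol' i i h
    · rw [hMsymm]
      exact hlt' j i hij (by rw [← h]; simpa using hA.1.isHermitian.apply i j))
  refine hne t ?_
  have hWV : Wᵀ * Vᵀ = 1 := by rw [← transpose_mul, hW, transpose_one]
  calc S = (Wᵀ * Vᵀ) * S * (V * W) := by rw [hWV, hW, Matrix.one_mul, Matrix.mul_one]
    _ = Wᵀ * (Vᵀ * S * V) * W := by simp only [Matrix.mul_assoc]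
    _ = t • ((Wᵀ * Vᵀ) * (V * W)) := by
      rw [ht, ← hV]
      simp only [Matrix.mul_assoc, Matrix.mul_smul, Matrix.smul_mul]
    _ = t • 1 := by rw [hWV, hW, Matrix.one_mul]

/-! ### The `5 × 5` case -/

theorem IsCompletelyPositive.isCompletelyPSD {n : ℕ} {A : Matrix (Fin n) (Fin n) ℝ}
    (hA : IsCompletelyPositive A) : IsCompletelyPSD A := by
  obtain ⟨d, hd, x, hx, hAx⟩ := hA
  refine ⟨d, hd, fun i => diagonal (x i), fun i => posSemidef_diagonal_iff.2 (hx i), fun i j => ?_⟩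
  rw [diagonal_transpose, diagonal_mul_diagonal, trace_diagonal, hAx]
  rfl

theorem isCompletelyPositive_zero {n : ℕ} :
    IsCompletelyPositive (0 : Matrix (Fin n) (Fin n) ℝ) :=
  ⟨1, le_rfl, 0, by simp, by simp⟩

/-- The non-neighbours of positive diagonal of a vertex of positive diagonal. -/
noncomputable def nonneighbors {n : ℕ} (A : Matrix (Fin n) (Fin n) ℝ) (i : Fin n) :
    Finset (Fin n) :=
  open Classical in {j | A i j = 0 ∧ A i i ≠ 0 ∧ A j j ≠ 0}

theorem sum_card_nonneighbors {A : Matrix (Fin 5) (Fin 5) ℝ} (hA : A.IsSymm) :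
    ∑ i, (nonneighbors A i).card = 2 * (nonadjacentPairs A).card := by
  classical
  have h1 : ∀ i j, (A i j = 0 ∧ A i i ≠ 0 ∧ A j j ≠ 0) ↔ (A j i = 0 ∧ A j j ≠ 0 ∧ A i i ≠ 0) := by
    intro i j
    rw [hA.apply i j]
    tauto
  have h2 : ∀ i, ¬ (A i i = 0 ∧ A i i ≠ 0 ∧ A i i ≠ 0) := by tauto
  have h3 : (nonadjacentPairs A).card = ∑ i, ∑ j,
      if i < j then (if A i j = 0 ∧ A i i ≠ 0 ∧ A j j ≠ 0 then 1 else 0) else 0 := by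
    rw [nonadjacentPairs, Finset.card_filter, Fintype.sum_prod_type]
    simp only [ite_and]
  have h4 : ∀ i, (nonneighbors A i).card =
      ∑ j, if A i j = 0 ∧ A i i ≠ 0 ∧ A j j ≠ 0 then 1 else 0 := by
    intro i
    rw [nonneighbors, Finset.card_filter]
  rw [h3]
  simp only [h4]
  generalize hz : (fun i j : Fin 5 => if A i j = 0 ∧ A i i ≠ 0 ∧ A j j ≠ 0 then 1 else 0) = z
  have hzz : ∀ i j, (if A i j = 0 ∧ A i i ≠ 0 ∧ A j j ≠ 0 then 1 else 0) = z i j :=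
    fun i j => congrFun (congrFun hz i) j
  have hzs : ∀ i j, z i j = z j i := fun i j => by
    rw [← hzz, ← hzz]
    exact if_congr (h1 i j) rfl rfl
  have hzd : ∀ i, z i i = 0 := fun i => by rw [← hzz, if_neg (h2 i)]
  simp only [hzz, Fin.sum_univ_five, hzd]
  simp only [Fin.isValue, Fin.reduceLT, if_true, if_false, hzs 1 0, hzs 2 0, hzs 3 0, hzs 4 0,
    hzs 2 1, hzs 3 1, hzs 4 1, hzs 3 2, hzs 4 2, hzs 4 3]
  ring

/-- The support of a nonzero matrix on an extreme ray of the `5 × 5` doubly nonnegative cone that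
is not completely positive is connected and triangle-free, and the matrix has rank three. -/
theorem IsExtremeRay.rank_eq_three {A : Matrix (Fin 5) (Fin 5) ℝ}
    {R : Set (Matrix (Fin 5) (Fin 5) ℝ)} (hR : IsExtremeRay (doublyNonnegative 5) R)
    (hAR : A ∈ R) (hcp : ¬ IsCompletelyPositive A) :
    A.rank = 3 ∧ (supportGraph A).Preconnected ∧ (supportGraph A).CliqueFree 3 := by
  have hA := hR.2.subset hAR
  have hsymm : A.IsSymm := by
    rw [IsSymm]
    simpa [conjTranspose_eq_transpose_of_trivial] using hA.1.isHermitian.eq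
  have hA0 : A ≠ 0 := by
    rintro rfl
    exact hcp isCompletelyPositive_zero
  have hnbr : ∀ i, A i i ≠ 0 → ∃ j k, i ≠ j ∧ i ≠ k ∧ j ≠ k ∧ A i j ≠ 0 ∧ A i k ≠ 0 ∧
      A j k = 0 := by
    intro i hi
    by_contra! h
    refine hcp (isCompletelyPositive_of_simplicial hR hAR hi fun j k hj hk => ?_)
    by_cases hij : i = j
    · rwa [← hij]
    by_cases hik : i = k
    · rwa [← hik, hsymm.apply]
    by_cases hjk : j = k
    · rw [← hjk]
      exact (entry_ne_zero_imp_diag_ne_zero hA.1 hj).2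
    exact h j k hij hik hjk hj hk
  obtain ⟨i₀, hi₀⟩ : ∃ i, A i i ≠ 0 := by
    by_contra! h
    refine hA0 (ext fun i j => ?_)
    by_contra hij
    exact (entry_ne_zero_imp_diag_ne_zero hA.1 hij).1 (h i)
  have hr2 : 2 < A.rank := by
    by_contra! hr
    obtain ⟨j, k, -, -, -, hj, hk, hjk⟩ := hnbr i₀ hi₀
    exact hcp (isCompletelyPositive_of_rank_le_two hA hr hjk
      (entry_ne_zero_imp_diag_ne_zero hA.1 hj).2 (entry_ne_zero_imp_diag_ne_zero hA.1 hk).2)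
  have hsub : ∀ i j k, A i i ≠ 0 → A i j ≠ 0 → A i k ≠ 0 →
      nonneighbors A i ⊆ ({i, j, k} : Finset (Fin 5))ᶜ := by
    intro i j k hi hj hk l hl
    simp only [nonneighbors, Finset.mem_filter, Finset.mem_univ, true_and] at hl
    simp only [Finset.mem_compl, Finset.mem_insert, Finset.mem_singleton]
    rintro (rfl | rfl | rfl)
    exacts [hi hl.1, hj hl.1, hk hl.1]
  have hcompl : ∀ i j k : Fin 5, i ≠ j → i ≠ k → j ≠ k →
      ({i, j, k} : Finset (Fin 5))ᶜ.card = 2 := by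
    intro i j k hij hik hjk
    rw [Finset.card_compl, Finset.card_eq_three.2 ⟨i, j, k, hij, hik, hjk, rfl⟩, Fintype.card_fin]
  have hle : ∀ i, (nonneighbors A i).card ≤ 2 := by
    intro i
    by_cases hi : A i i = 0
    · simp [nonneighbors, hi]
    obtain ⟨j, k, hij, hik, hjk, hj, hk, -⟩ := hnbr i hi
    exact (Finset.card_le_card (hsub i j k hi hj hk)).trans_eq (hcompl i j k hij hik hjk)
  have hsum := sum_card_nonneighbors hsymm
  have hchoose := hR.choose_rank_le hAR hA0
  have hpairs : (nonadjacentPairs A).card ≤ 5 := by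
    have h := Finset.sum_le_sum fun i (_ : i ∈ Finset.univ) => hle i
    rw [hsum] at h
    simp at h
    omega
  have hr3 : A.rank = 3 := by
    refine le_antisymm ?_ hr2
    -- Rank at least four would need `10 ≤ 5 + 1`.
    by_contra! h
    have := Nat.choose_le_choose 2 (show 5 ≤ A.rank + 1 by omega)
    have h5 : Nat.choose 5 2 = 10 := rfl
    omega
  have hpairs' : (nonadjacentPairs A).card = 5 := by
    rw [hr3] at hchoose
    have h4 : Nat.choose (3 + 1) 2 = 6 := rfl
    omega
  have heq : ∀ i, (nonneighbors A i).card = 2 := by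
    have h := (Finset.sum_eq_sum_iff_of_le fun i (_ : i ∈ Finset.univ) => hle i).1
      (by rw [hsum, hpairs']; simp)
    exact fun i => h i (Finset.mem_univ i)
  have hdiag : ∀ i, A i i ≠ 0 := fun i hi => by
    have := heq i
    simp [nonneighbors, hi] at this
  have hstruct : ∀ i, ∃ j k, i ≠ j ∧ i ≠ k ∧ j ≠ k ∧ A j k = 0 ∧
      ∀ l, A i l ≠ 0 ↔ l = i ∨ l = j ∨ l = k := by
    intro i
    obtain ⟨j, k, hij, hik, hjk, hj, hk, h0⟩ := hnbr i (hdiag i)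
    have h := Finset.eq_of_subset_of_card_le (hsub i j k (hdiag i) hj hk)
      (by rw [hcompl i j k hij hik hjk, heq])
    refine ⟨j, k, hij, hik, hjk, h0, fun l => ?_⟩
    have hl := Finset.ext_iff.1 h l
    simp only [nonneighbors, Finset.mem_filter, Finset.mem_univ, true_and, Finset.mem_compl,
      Finset.mem_insert, Finset.mem_singleton, hdiag, ne_eq, not_false_eq_true, and_true] at hl
    rw [ne_eq, hl, not_not]
  refine ⟨hr3, fun a b => ?_, fun s hs => ?_⟩
  · obtain ⟨j, k, hij, hik, hjk, -, ha⟩ := hstruct a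
    obtain ⟨j', k', hij', hik', hjk', -, hb⟩ := hstruct b
    -- Two closed neighbourhoods of size three among five vertices must meet.
    obtain ⟨l, hl, hl'⟩ : ∃ l, l ∈ ({a, j, k} : Finset (Fin 5)) ∧
        l ∈ ({b, j', k'} : Finset (Fin 5)) := by
      by_contra! h
      have hd : Disjoint ({a, j, k} : Finset (Fin 5)) {b, j', k'} :=
        Finset.disjoint_left.2 h
      have := Finset.card_le_univ (({a, j, k} : Finset (Fin 5)) ∪ {b, j', k'})
      rw [Finset.card_union_of_disjoint hd, Finset.card_eq_three.2 ⟨a, j, k, hij, hik, hjk, rfl⟩,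
        Finset.card_eq_three.2 ⟨b, j', k', hij', hik', hjk', rfl⟩, Fintype.card_fin] at this
      omega
    have hreach : ∀ i, A i l ≠ 0 → (supportGraph A).Reachable i l := fun i h => by
      by_cases hil : i = l
      · rw [hil]
      · exact ((supportGraph_adj hsymm).2 ⟨hil, h⟩).reachable
    exact (hreach a ((ha l).2 (by simpa using hl))).trans
      (hreach b ((hb l).2 (by simpa using hl'))).symm
  · obtain ⟨a, b, c, hab, hac, hbc, -⟩ := SimpleGraph.is3Clique_iff.1 hs
    rw [supportGraph_adj hsymm] at hab hac hbc
    obtain ⟨j, k, -, -, -, h0, h⟩ := hstruct a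
    have h0' : A k j = 0 := by rw [hsymm.apply, h0]
    rcases (h b).1 hab.2 with rfl | rfl | rfl
    · exact hab.1 rfl
    · rcases (h c).1 hac.2 with rfl | rfl | rfl
      exacts [hac.1 rfl, hbc.1 rfl, hbc.2 h0]
    · rcases (h c).1 hac.2 with rfl | rfl | rfl
      exacts [hac.1 rfl, hbc.2 h0', hbc.1 rfl]

theorem lemma3p10 :
    (∀ n : ℕ, 5 ≤ n → Odd n → ∀ A : Matrix (Fin n) (Fin n) ℝ, A.IsSymm →
      Nonempty (supportGraph A ≃g SimpleGraph.cycleGraph n) → A.rank = n - 2 →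
      ¬ IsCompletelyPSD A) ∧
    (∀ (A : Matrix (Fin 5) (Fin 5) ℝ) (R : Set (Matrix (Fin 5) (Fin 5) ℝ)),
      IsExtremeRay (doublyNonnegative 5) R → A ∈ R →
      (IsCompletelyPSD A ↔ IsCompletelyPositive A)) := by
  refine ⟨fun n hn _ A _ ⟨e⟩ hr => not_isCompletelyPSD_of_cycle (by omega) e hr,
    fun A R hR hAR => ⟨fun hA => ?_, IsCompletelyPositive.isCompletelyPSD⟩⟩
  by_contra hcp
  obtain ⟨hr, hconn, htri⟩ := hR.rank_eq_three hAR hcp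
  have := hA.le_rank_add_one hconn htri
  omega
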